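/- Let $G$ be a finite simple connected graph with $n$ vertices, $m$ edges and minimum degree $\delta(G)\ge 3$. Let $D(G)$ be the set of its $2m$ oriented edges (each edge with both orientations); for $e\in D(G)$ write $o(e)$, $t(e)$, $e^{-1}$ for its origin, its terminus and its inverse. A pair $(e,f)$ of oriented edges is a 2-step-arc if there is $g\in D(G)$ with $g\ne e^{-1}$, $g\ne f^{-1}$, $o(g)=t(e)$ and $t(g)=o(f)$; it is a 2-step-identity if $e=f$. A 2-step-cycle of length $|C|=\ell\ge 1$ is a sequence $C=(e_0,\dots,e_{\ell-1})$ of oriented edges such that, for every $i\in\mathbb{Z}/\ell\mathbb{Z}$, $(e_i,e_{i+1})$ is a 2-step-arc or a 2-step-identity. It is prime if it is not obtained by going $r$ times around a strictly shorter 2-step-cycle, for any $r$. Two 2-step-cycles are equivalent if one is a cyclic permutation of the other. The modified zeta function of $G$ is $$\tilde{\mathbf Z}_G(u)=\prod_{[C]}\bigl(1-u^{|C|}\bigr)^{-1},$$ where $[C]$ runs over the equivalence classes of prime 2-step-cycles. Then the product converges for all complex $u$ with $|u|$ sufficiently small, it has a (necessarily unique) meromorphic continuation to $\mathbb{C}$,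 again denoted $\tilde{\mathbf Z}_G$, and $u=1/2$ is a pole of $\tilde{\mathbf Z}_G$, of order exactly $$2(m-n+1)\ \text{ if } G \text{ is bipartite},\qquad 2(m-n)+1\ \text{ if } G \text{ is not bipartite}.$$ -/

import Mathlib

open Filter Topology

namespace ModifiedZeta

variable {V : Type*}

/-- The ordered pair `(e, f)` of oriented edges is a 2-step-arc: some oriented edge `g`,
different from `e⁻¹` and from `f⁻¹`, runs from the terminus of `e` to the origin of `f`. -/
def IsTwoStepArc (G : SimpleGraph V) (e f : G.Dart) : Prop :=
  ∃ g : G.Dart, g ≠ e.symm ∧ g ≠ f.symm ∧ g.fst = e.snd ∧ g.snd = f.fst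

/-- `(e, f)` is a 2-step-arc or a 2-step-identity. -/
def TwoStep (G : SimpleGraph V) (e f : G.Dart) : Prop :=
  IsTwoStepArc G e f ∨ e = f

/-- A 2-step-cycle of length `ℓ ≥ 1`: a sequence `(e₀, …, e_{ℓ-1})` of oriented edges in which
every cyclically consecutive pair `(eᵢ, eᵢ₊₁)`, `i ∈ ℤ/ℓℤ`, is a 2-step-arc or a
2-step-identity. (For `ℓ = 1` the only such pair is `(e₀, e₀)`.) -/
def IsTwoStepCycle (G : SimpleGraph V) (l : List G.Dart) : Prop :=
  l ≠ [] ∧ Cycle.Chain (TwoStep G) (l : Cycle G.Dart)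

/-- A 2-step-cycle is prime if it is not obtained by going `r` times around a strictly shorter
2-step-cycle. -/
def IsPrimeTwoStepCycle (G : SimpleGraph V) (l : List G.Dart) : Prop :=
  IsTwoStepCycle G l ∧
    ∀ (b : List G.Dart) (r : ℕ), IsTwoStepCycle G b → b.length < l.length →
      l ≠ (List.replicate r b).flatten

/-- The equivalence classes `[C]`, under cyclic permutation, of prime 2-step-cycles. (`Cycle α` is
the quotient of `List α` by cyclic permutation.) -/
def PrimeClass (G : SimpleGraph V) : Type _ :=
  {c : Cycle G.Dart // ∃ l : List G.Dart, IsPrimeTwoStepCycle G l ∧ (l : Cycle G.Dart) = c}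

/-- The factor `(1 - u ^ |C|)⁻¹` of the Euler product belonging to the class `[C]`. -/
noncomputable def eulerFactor (G : SimpleGraph V) (u : ℂ) (c : PrimeClass G) : ℂ :=
  (1 - u ^ c.1.length)⁻¹

/-- The modified zeta function of `G`, as an Euler product, for `u` near `0`. -/
noncomputable def modifiedZeta (G : SimpleGraph V) (u : ℂ) : ℂ :=
  ∏' c : PrimeClass G, eulerFactor G u c

/-- `Z` is a meromorphic function on the whole complex plane that agrees near `0` with `f`. -/
def IsMeromorphicContinuation (f Z : ℂ → ℂ) : Prop :=
  Meromorphic Z ∧ ∀ᶠ u in 𝓝 (0 : ℂ), Z u = f u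

/-- `Z` has a pole of order exactly `k ≥ 1` at `a`. -/
def HasPoleOfOrder (Z : ℂ → ℂ) (a : ℂ) (k : ℤ) : Prop :=
  MeromorphicAt Z a ∧ 0 < k ∧ meromorphicOrderAt Z a = ((-k : ℤ) : WithTop ℤ)

end ModifiedZeta

/-!
Let `B` be the non-backtracking edge matrix. Since `B²` is the `0`-`1` matrix of the 2-step-arcs,
and no oriented edge is joined to itself by a 2-step-arc, the 2-step-cycles are the admissible
cyclic words of the Markov chain with transition matrix `M = B² + 1`, and the prime classes are its
periodic orbits. Counting periodic points by traces of powers of `M` gives the Euler product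
`1 / det (1 - u M)`, so the order of the pole at `1 / 2` is the algebraic multiplicity of the
eigenvalue `2` of `M`.

The `2`-eigenvectors of `M` are the functions on oriented edges whose sums over the edges leaving
and over the edges entering each vertex vanish. The range of `M - 2 = B² - 1` is orthogonal to
them, so the algebraic multiplicity is the geometric one, and rank-nullity for the two incidence
maps gives `2 m - 2 n + 1`, plus `1` if there is a function on the vertices that changes sign along
every edge, that is, if the graph is bipartite.
-/

namespace ModifiedZeta

section PeriodicOrbits

open Function

variable {X : Type*} {f : X → X}

/-- The set of periodic orbits of `f`; a periodic orbit of `p` points is encoded as the cycle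
`x, f x, …, f^[p - 1] x`. -/
def periodicOrbits (f : X → X) : Set (Cycle X) := periodicOrbit f '' periodicPts f

/-- The map sending a periodic point to its orbit. -/
noncomputable def toPeriodicOrbit (x : periodicPts f) : periodicOrbits f :=
  ⟨periodicOrbit f x, x, x.2, rfl⟩

lemma periodicOrbit_eq_iff_mem {x y : X} (hx : x ∈ periodicPts f) (hy : y ∈ periodicPts f) :
    periodicOrbit f y = periodicOrbit f x ↔ y ∈ periodicOrbit f x := by
  refine ⟨fun h => h ▸ self_mem_periodicOrbit hy, fun h => ?_⟩
  obtain ⟨i, rfl⟩ := (mem_periodicOrbit_iff hx).1 h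
  exact periodicOrbit_apply_iterate_eq hx i

lemma iterate_mem_periodicPts {x : X} (hx : x ∈ periodicPts f) (n : ℕ) :
    f^[n] x ∈ periodicPts f := by
  obtain ⟨p, hp, h⟩ := hx
  exact ⟨p, hp, h.apply_iterate n⟩

/-- The points of a periodic orbit, enumerated from a base point. -/
noncomputable def finMinimalPeriodEquiv (x : periodicPts f) :
    Fin (minimalPeriod f x) ≃ toPeriodicOrbit (f := f) ⁻¹' {toPeriodicOrbit x} :=
  Equiv.ofBijective
    (fun i => ⟨⟨f^[i] x, iterate_mem_periodicPts x.2 i⟩,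
      Subtype.ext (periodicOrbit_apply_iterate_eq x.2 i)⟩) <| by
    constructor
    · intro i j h
      refine Fin.ext (iterate_injOn_Iio_minimalPeriod i.2 j.2 ?_)
      exact congrArg (fun y => (y.1 : X)) h
    · rintro ⟨y, hy⟩
      have hy' : y.1 ∈ periodicOrbit f x :=
        (periodicOrbit_eq_iff_mem x.2 y.2).1 (congrArg Subtype.val hy)
      obtain ⟨i, hi⟩ := (mem_periodicOrbit_iff x.2).1 hy'
      refine ⟨⟨i % minimalPeriod f x, Nat.mod_lt _ (minimalPeriod_pos_of_mem_periodicPts x.2)⟩, ?_⟩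
      exact Subtype.ext (Subtype.ext (by simpa only [iterate_mod_minimalPeriod_eq] using hi))

/-- A point of period `n` is a periodic point `x` together with the integer `k` for which `n` is
`k` times the minimal period of `x`. -/
noncomputable def periodicPtsProdPNatEquiv (f : X → X) :
    periodicPts f × ℕ+ ≃ Σ n : ℕ+, ptsOfPeriod f n :=
  Equiv.ofBijective
    (fun z => ⟨⟨minimalPeriod f z.1, minimalPeriod_pos_of_mem_periodicPts z.1.2⟩ * z.2,
      z.1, by exact (isPeriodicPt_minimalPeriod f z.1).mul_const z.2⟩) <| by
    constructor
    · rintro ⟨⟨x, hx⟩, k⟩ ⟨⟨y, hy⟩, l⟩ h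
      obtain rfl : x = y := congrArg (fun p : Σ n : ℕ+, ptsOfPeriod f n => p.2.1) h
      rw [show k = l from mul_left_cancel (congrArg Sigma.fst h)]
    · rintro ⟨n, x, hx⟩
      obtain ⟨k, hk⟩ := IsPeriodicPt.minimalPeriod_dvd hx
      have hk0 : 0 < k := Nat.pos_of_ne_zero fun h => n.ne_zero (by rw [hk, h, mul_zero])
      exact ⟨⟨⟨x, mk_mem_periodicPts n.pos hx⟩, ⟨k, hk0⟩⟩,
        Sigma.subtype_ext (PNat.eq hk.symm) rfl⟩

lemma hasSum_ptsOfPeriod [∀ n : ℕ+, Finite (ptsOfPeriod f n)] {u s : ℂ}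
    (h : HasSum (fun n : ℕ+ => Nat.card (ptsOfPeriod f n) * (u ^ (n : ℕ) / n)) s) :
    HasSum (fun z : Σ n : ℕ+, ptsOfPeriod f n => u ^ (z.1 : ℕ) / z.1) s := by
  have hfiber (n : ℕ+) : HasSum (fun _ : ptsOfPeriod f n => u ^ (n : ℕ) / n)
      (Nat.card (ptsOfPeriod f n) * (u ^ (n : ℕ) / n)) := by
    have := Fintype.ofFinite (ptsOfPeriod f n)
    simpa using hasSum_fintype fun _ : ptsOfPeriod f n => u ^ (n : ℕ) / n
  refine HasSum.sigma_of_hasSum h hfiber (.of_norm ?_)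
  refine (summable_sigma_of_nonneg fun _ => norm_nonneg _).2 ⟨fun n => Summable.of_finite, ?_⟩
  refine h.summable.norm.congr fun n => ?_
  simp

lemma hasSum_pnat_pow_div {z : ℂ} (hz : ‖z‖ < 1) :
    HasSum (fun n : ℕ+ => z ^ (n : ℕ) / n) (-Complex.log (1 - z)) :=
  hasSum_pnat_iff (f := fun n : ℕ => z ^ n / n).2 <| by
    simpa using Complex.hasSum_taylorSeries_neg_log hz

lemma norm_pow_minimalPeriod_lt_one {x : X} (hx : x ∈ periodicPts f) {u : ℂ} (hu : ‖u‖ < 1) :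
    ‖u ^ minimalPeriod f x‖ < 1 := by
  simpa only [norm_pow] using
    pow_lt_one₀ (norm_nonneg u) hu (minimalPeriod_pos_of_mem_periodicPts hx).ne'

lemma hasSum_neg_log_periodicPts {u s : ℂ} (hu : ‖u‖ < 1)
    (h : HasSum (fun z : Σ n : ℕ+, ptsOfPeriod f n => u ^ (z.1 : ℕ) / z.1) s) :
    HasSum (fun x : periodicPts f =>
      -Complex.log (1 - u ^ minimalPeriod f x) / minimalPeriod f x) s := by
  refine ((periodicPtsProdPNatEquiv f).hasSum_iff.2 h).prod_fiberwise fun x => ?_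
  have hlog := hasSum_pnat_pow_div (norm_pow_minimalPeriod_lt_one x.2 hu)
  refine (hlog.div_const (minimalPeriod f x : ℂ)).congr_fun fun k => ?_
  change u ^ (minimalPeriod f x * k) / ((minimalPeriod f x * k : ℕ) : ℂ) = _
  rw [pow_mul, div_div, Nat.cast_mul, mul_comm (k : ℂ)]

theorem hasProd_periodicOrbits [∀ n : ℕ+, Finite (ptsOfPeriod f n)] {u s : ℂ} (hu : ‖u‖ < 1)
    (h : HasSum (fun n : ℕ+ => Nat.card (ptsOfPeriod f n) * (u ^ (n : ℕ) / n)) s) :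
    HasProd (fun γ : periodicOrbits f => (1 - u ^ γ.1.length)⁻¹) (Complex.exp s) := by
  have hsum : HasSum (fun γ : periodicOrbits f => -Complex.log (1 - u ^ γ.1.length)) s := by
    refine HasSum.sigma ((Equiv.sigmaFiberEquiv (toPeriodicOrbit (f := f))).hasSum_iff.2
      (hasSum_neg_log_periodicPts hu (hasSum_ptsOfPeriod h))) ?_
    rintro ⟨_, x, hx, rfl⟩
    have hp : (minimalPeriod f x : ℂ) ≠ 0 := by
      exact_mod_cast (minimalPeriod_pos_of_mem_periodicPts hx).ne'
    refine ((finMinimalPeriodEquiv ⟨x, hx⟩).hasSum_iff).1 ?_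
    have hconst := hasSum_fintype fun _ : Fin (minimalPeriod f x) =>
      -Complex.log (1 - u ^ minimalPeriod f x) / minimalPeriod f x
    simp only [Finset.sum_const, Finset.card_univ, Fintype.card_fin, nsmul_eq_mul,
      mul_div_cancel₀ _ hp] at hconst
    rw [periodicOrbit_length]
    refine hconst.congr_fun fun i => ?_
    change -Complex.log (1 - u ^ minimalPeriod f (f^[i] x)) / minimalPeriod f (f^[i] x) = _
    rw [minimalPeriod_apply_iterate hx]
  refine hsum.cexp.congr_fun ?_
  rintro ⟨_, x, hx, rfl⟩
  have hne : 1 - u ^ minimalPeriod f x ≠ 0 := sub_ne_zero.2 fun h =>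
    (norm_pow_minimalPeriod_lt_one hx hu).ne (by rw [← h, norm_one])
  simp only [Function.comp_apply, periodicOrbit_length, Complex.exp_neg, Complex.exp_log hne]

end PeriodicOrbits

section MarkovShift

open Function

variable {α : Type*}

/-- The one-sided topological Markov chain of a relation `R`: the infinite sequences in which any
two consecutive terms are related by `R`. -/
abbrev MarkovShift (R : α → α → Prop) : Type _ := {x : ℕ → α // ∀ i, R (x i) (x (i + 1))}

variable {R : α → α → Prop}

/-- The shift map of a topological Markov chain. -/
def shift (x : MarkovShift R) : MarkovShift R :=
  ⟨fun i => x.1 (i + 1), fun i => x.2 (i + 1)⟩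

/-- The word formed by the first `n` terms of `x`. -/
def word (n : ℕ) (x : MarkovShift R) : List α := List.ofFn fun i : Fin n => x.1 i

lemma length_word (n : ℕ) (x : MarkovShift R) : (word n x).length = n := List.length_ofFn

lemma iterate_shift_apply (n : ℕ) (x : MarkovShift R) (i : ℕ) :
    (shift^[n] x).1 i = x.1 (i + n) := by
  induction n generalizing x with
  | zero => rfl
  | succ _ ih => exact ih (shift x)

lemma isPeriodicPt_shift_iff {n : ℕ} {x : MarkovShift R} :
    IsPeriodicPt shift n x ↔ Periodic x.1 n := by
  simp only [IsPeriodicPt, IsFixedPt, Subtype.ext_iff, funext_iff, iterate_shift_apply, Periodic]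

lemma word_mul {n : ℕ} {x : MarkovShift R} (hx : IsPeriodicPt shift n x) (r : ℕ) :
    word (n * r) x = (List.replicate r (word n x)).flatten := by
  have hper (i j : ℕ) : x.1 (n * i + j) = x.1 j := by
    rw [add_comm, mul_comm]
    exact (isPeriodicPt_shift_iff.1 hx).nat_mul i j
  simp only [word, List.ofFn_mul', hper, List.ofFn_const]

lemma word_iterate_shift {n : ℕ} {x : MarkovShift R} (hx : IsPeriodicPt shift n x) (k : ℕ) :
    word n (shift^[k] x) = (word n x).rotate k := by
  refine List.ext_getElem (by simp [word]) fun i _ _ => ?_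
  simp [word, List.getElem_rotate, iterate_shift_apply,
    (isPeriodicPt_shift_iff.1 hx).map_mod_nat]

lemma eq_of_word_eq {n : ℕ} (hn : n ≠ 0) {x y : MarkovShift R} (hx : IsPeriodicPt shift n x)
    (hy : IsPeriodicPt shift n y) (h : word n x = word n y) : x = y := by
  refine Subtype.ext (funext fun i => ?_)
  rw [← (isPeriodicPt_shift_iff.1 hx).map_mod_nat i, ← (isPeriodicPt_shift_iff.1 hy).map_mod_nat i]
  exact congrFun (List.ofFn_injective h) ⟨i % n, Nat.mod_lt _ (Nat.pos_of_ne_zero hn)⟩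

lemma chain_ofFn_iff_of_periodic {n : ℕ} (hn : n ≠ 0) {x : ℕ → α} (hx : Periodic x n) :
    Cycle.Chain R (List.ofFn fun i : Fin n => x i : List α) ↔ ∀ i, R (x i) (x (i + 1)) := by
  obtain ⟨n, rfl⟩ := Nat.exists_eq_succ_of_ne_zero hn
  have hmap : List.ofFn (fun i : Fin (n + 1) => x i) = (List.range (n + 1)).map x := by
    rw [List.ofFn_eq_map, ← List.map_coe_finRange_eq_range, List.map_map]
    rfl
  rw [hmap, ← Cycle.map_coe, Cycle.chain_map, Cycle.chain_range_succ]
  refine ⟨fun h i => ?_, fun h => ⟨?_, fun m _ => h m⟩⟩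
  · have hsucc : x (i % (n + 1) + 1) = x (i + 1) := by
      rw [← hx.map_mod_nat, Nat.mod_add_mod, hx.map_mod_nat]
    rw [← hsucc, ← hx.map_mod_nat i]
    rcases (Nat.lt_succ_iff.1 (Nat.mod_lt i n.succ_pos)).eq_or_lt with hlast | hlt
    · rw [hlast, hx.eq]
      exact h.1
    · exact h.2 _ hlt
  · exact hx.eq ▸ h n

lemma chain_word {n : ℕ} (hn : n ≠ 0) {x : MarkovShift R} (hx : IsPeriodicPt shift n x) :
    Cycle.Chain R (word n x) :=
  (chain_ofFn_iff_of_periodic hn (isPeriodicPt_shift_iff.1 hx)).2 x.2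

lemma exists_word_eq {n : ℕ} (hn : n ≠ 0) {w : Fin n → α} (hw : Cycle.Chain R (List.ofFn w)) :
    ∃ x : MarkovShift R, IsPeriodicPt shift n x ∧ word n x = List.ofFn w := by
  have hlt (i : ℕ) : i % n < n := Nat.mod_lt _ (Nat.pos_of_ne_zero hn)
  let x (i : ℕ) : α := w ⟨i % n, hlt i⟩
  have hx : Periodic x n := fun i => by simp only [x, Nat.add_mod_right]
  have hxw : (fun i : Fin n => x i) = w := funext fun i => by
    simp only [x, Nat.mod_eq_of_lt i.2]
  rw [← hxw] at hw ⊢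
  exact ⟨⟨x, (chain_ofFn_iff_of_periodic hn hx).1 hw⟩, isPeriodicPt_shift_iff.2 hx, rfl⟩

/-- Points of period `n` of the shift correspond to cyclically admissible words of length `n`. -/
noncomputable def ptsOfPeriodEquiv (R : α → α → Prop) {n : ℕ} (hn : n ≠ 0) :
    ptsOfPeriod (shift (R := R)) n ≃ {w : Fin n → α // Cycle.Chain R (List.ofFn w)} :=
  Equiv.ofBijective (fun x => ⟨fun i => x.1.1 i, chain_word hn x.2⟩) <| by
    constructor
    · intro x y h
      exact Subtype.ext (eq_of_word_eq hn x.2 y.2 (congrArg List.ofFn (congrArg Subtype.val h)))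
    · rintro ⟨w, hw⟩
      obtain ⟨x, hx, hxw⟩ := exists_word_eq hn hw
      exact ⟨⟨x, hx⟩, Subtype.ext (List.ofFn_injective hxw)⟩

lemma map_periodicOrbit_shift (x : MarkovShift R) :
    (periodicOrbit shift x).map (fun y => y.1 0) = (word (minimalPeriod shift x) x : Cycle α) := by
  rw [periodicOrbit_def, Cycle.map_coe, List.map_map]
  refine congrArg _ (List.ext_getElem (by simp [word]) fun i _ _ => ?_)
  simp [word, iterate_shift_apply]

lemma periodicOrbit_shift_injective {x y : MarkovShift R} (hx : x ∈ periodicPts shift)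
    (h : (periodicOrbit shift x).map (fun z => z.1 0) =
      (periodicOrbit shift y).map fun z => z.1 0) :
    periodicOrbit shift x = periodicOrbit shift y := by
  rw [map_periodicOrbit_shift, map_periodicOrbit_shift, Cycle.coe_eq_coe] at h
  have hxp := isPeriodicPt_minimalPeriod shift x
  have hlen : minimalPeriod shift x = minimalPeriod shift y := by
    simpa only [length_word] using h.perm.length_eq
  obtain ⟨k, hk⟩ := h
  rw [← word_iterate_shift hxp, ← hlen] at hk
  have hxy : shift^[k] x = y :=
    eq_of_word_eq (minimalPeriod_pos_of_mem_periodicPts hx).ne' (hxp.apply_iterate k)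
      (hlen ▸ isPeriodicPt_minimalPeriod shift y) hk
  rw [← hxy, periodicOrbit_apply_iterate_eq hx]

instance finite_ptsOfPeriod_shift [Finite α] (n : ℕ+) :
    Finite (ptsOfPeriod (shift (R := R)) n) :=
  Finite.of_equiv _ (ptsOfPeriodEquiv R n.ne_zero).symm

section Counting

variable [Fintype α]

open Classical in
/-- The transition matrix of a relation `R`: the `0`-`1` matrix whose entry at `(a, b)` is `1` if
`R a b`. Its powers count the periodic points of the Markov chain of `R`. -/
noncomputable def transitionMatrix (R : α → α → Prop) : Matrix α α ℂ :=
  Matrix.of fun a b => if R a b then 1 else 0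

open Classical in
lemma transitionMatrix_pow_succ_apply [DecidableEq α] (n : ℕ) (a b : α) :
    (transitionMatrix R ^ (n + 1)) a b =
      ∑ w : Fin n → α, if List.IsChain R (a :: (List.ofFn w ++ [b])) then (1 : ℂ) else 0 := by
  induction n generalizing a with
  | zero => simp [transitionMatrix]
  | succ n ih =>
    rw [pow_succ', Matrix.mul_apply, ← (Fin.consEquiv fun _ => α).sum_comp,
      Fintype.sum_prod_type]
    refine Finset.sum_congr rfl fun c _ => ?_
    rw [ih, Finset.mul_sum]
    refine Finset.sum_congr rfl fun w _ => ?_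
    by_cases h : R a c <;> simp [transitionMatrix, Fin.consEquiv, List.ofFn_succ, h]

open Classical in
lemma trace_transitionMatrix_pow [DecidableEq α] {n : ℕ} (hn : n ≠ 0) :
    (transitionMatrix R ^ n).trace = Nat.card (ptsOfPeriod (shift (R := R)) n) := by
  rw [Nat.card_congr (ptsOfPeriodEquiv R hn), Nat.card_eq_fintype_card, Fintype.card_subtype,
    Finset.natCast_card_filter]
  obtain ⟨n, rfl⟩ := Nat.exists_eq_succ_of_ne_zero hn
  rw [← (Fin.consEquiv fun _ => α).sum_comp, Fintype.sum_prod_type, Matrix.trace]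
  refine Finset.sum_congr rfl fun c _ => ?_
  rw [Matrix.diag_apply, transitionMatrix_pow_succ_apply]
  simp [Fin.consEquiv, List.ofFn_succ, Cycle.chain_coe_cons]

end Counting

end MarkovShift

section PrimeClasses

open Function

variable {V : Type*} {G : SimpleGraph V}

lemma isPrimeTwoStepCycle_word {x : MarkovShift (TwoStep G)} (hx : x ∈ periodicPts shift) :
    IsPrimeTwoStepCycle G (word (minimalPeriod shift x) x) := by
  have hp : minimalPeriod shift x ≠ 0 := (minimalPeriod_pos_of_mem_periodicPts hx).ne'
  have hxp := isPeriodicPt_minimalPeriod shift x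
  refine ⟨⟨fun h => hp ?_, chain_word hp hxp⟩, fun b r hb hlt hpow => ?_⟩
  · rw [← length_word (minimalPeriod shift x) x, h, List.length_nil]
  have hq : b.length ≠ 0 := List.length_eq_zero_iff.not.2 hb.1
  obtain ⟨y, hy, hyb⟩ := exists_word_eq (R := TwoStep G) hq (w := b.get) (by
    simpa only [List.ofFn_get] using hb.2)
  rw [List.ofFn_get] at hyb
  have hlen : minimalPeriod shift x = b.length * r := by
    simpa [length_word, mul_comm] using congrArg List.length hpow
  have hxy : x = y := by
    refine eq_of_word_eq hp hxp (hlen ▸ hy.mul_const r) ?_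
    rw [hpow, hlen, word_mul hy, hyb]
  subst hxy
  rw [length_word] at hlt
  exact hlt.not_ge (hy.minimalPeriod_le (Nat.pos_of_ne_zero hq))

lemma IsPrimeTwoStepCycle.exists_word_eq {l : List G.Dart} (hl : IsPrimeTwoStepCycle G l) :
    ∃ x : MarkovShift (TwoStep G), x ∈ periodicPts shift ∧
      word (minimalPeriod shift x) x = l := by
  have hn : l.length ≠ 0 := List.length_eq_zero_iff.not.2 hl.1.1
  obtain ⟨x, hx, hxl⟩ := ModifiedZeta.exists_word_eq (R := TwoStep G) hn (w := l.get) (by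
    simpa only [List.ofFn_get] using hl.1.2)
  rw [List.ofFn_get] at hxl
  have hper : x ∈ periodicPts shift := mk_mem_periodicPts (Nat.pos_of_ne_zero hn) hx
  have hxp := isPeriodicPt_minimalPeriod shift x
  obtain ⟨r, hr⟩ := hx.minimalPeriod_dvd
  have hle : l.length ≤ (word (minimalPeriod shift x) x).length := not_lt.1 fun hlt =>
    hl.2 _ r (isPrimeTwoStepCycle_word hper).1 hlt (by rw [← word_mul hxp, ← hr, hxl])
  rw [length_word] at hle
  have hmin : minimalPeriod shift x = l.length :=
    (hx.minimalPeriod_le (Nat.pos_of_ne_zero hn)).antisymm hle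
  exact ⟨x, hper, hmin.symm ▸ hxl⟩

/-- The periodic orbits of the shift correspond to the classes of prime 2-step-cycles. -/
noncomputable def periodicOrbitsEquivPrimeClass (G : SimpleGraph V) :
    periodicOrbits (shift (R := TwoStep G)) ≃ PrimeClass G :=
  Equiv.ofBijective
    (fun γ => ⟨γ.1.map fun y => y.1 0, by
      obtain ⟨_, x, hx, rfl⟩ := γ
      exact ⟨_, isPrimeTwoStepCycle_word hx, (map_periodicOrbit_shift x).symm⟩⟩) <| by
    constructor
    · rintro ⟨_, x, hx, rfl⟩ ⟨_, y, hy, rfl⟩ h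
      exact Subtype.ext (periodicOrbit_shift_injective hx (congrArg Subtype.val h))
    · rintro ⟨_, l, hl, rfl⟩
      obtain ⟨x, hx, rfl⟩ := hl.exists_word_eq
      exact ⟨toPeriodicOrbit ⟨x, hx⟩, Subtype.ext (map_periodicOrbit_shift x)⟩

lemma length_periodicOrbitsEquivPrimeClass (γ : periodicOrbits (shift (R := TwoStep G))) :
    (periodicOrbitsEquivPrimeClass G γ).1.length = γ.1.length := by
  obtain ⟨_, x, hx, rfl⟩ := γ
  rw [periodicOrbit_length, ← length_word (minimalPeriod shift x) x, ← Cycle.length_coe,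
    ← map_periodicOrbit_shift]
  rfl

end PrimeClasses

section Eigenvalues

open Polynomial

variable {n K : Type*} [Fintype n] [DecidableEq n] [Field K]

lemma det_one_sub_smul_eq_pow_mul_eval_charpoly (A : Matrix n n K) {u : K} (hu : u ≠ 0) :
    (1 - u • A).det = u ^ Fintype.card n * A.charpoly.eval u⁻¹ := by
  rw [Matrix.eval_charpoly, ← Matrix.det_smul, smul_sub, Matrix.scalar_apply,
    ← Matrix.smul_one_eq_diagonal, smul_smul, mul_inv_cancel₀ hu, one_smul]

variable [IsAlgClosed K]

lemma card_roots_charpoly (A : Matrix n n K) : A.charpoly.roots.card = Fintype.card n := by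
  rw [← (IsAlgClosed.splits A.charpoly).natDegree_eq_card_roots, A.charpoly_natDegree_eq_dim]

lemma eval_charpoly_eq_prod_roots (A : Matrix n n K) (z : K) :
    A.charpoly.eval z = (A.charpoly.roots.map fun x => z - x).prod :=
  (IsAlgClosed.splits A.charpoly).eval_eq_prod_roots_of_monic A.charpoly_monic z

lemma det_aeval_eq_prod_roots (A : Matrix n n K) (p : K[X]) :
    (aeval A p).det = (A.charpoly.roots.map fun x => p.eval x).prod := by
  induction IsAlgClosed.splits p using Submonoid.closure_induction with
  | mem p hp =>
    obtain ⟨a, rfl⟩ | ⟨a, rfl⟩ := hp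
    · simp [Matrix.algebraMap_eq_diagonal, card_roots_charpoly]
    · have hneg : aeval A (X + C a) = -(Matrix.scalar n (-a) - A) := by
        simp [Matrix.algebraMap_eq_diagonal, Pi.algebraMap_def, ← Matrix.diagonal_neg]
      have heval : (fun x => (X + C a).eval x) = fun x => -1 * (-a - x) := by
        ext x
        simp [add_comm]
      rw [hneg, Matrix.det_neg, ← Matrix.eval_charpoly, eval_charpoly_eq_prod_roots, heval,
        Multiset.prod_map_mul, Multiset.map_const', Multiset.prod_replicate, card_roots_charpoly]
  | one => simp
  | mul p q _ _ hp hq =>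
    simp only [map_mul, Matrix.det_mul, hp, hq, eval_mul, Multiset.prod_map_mul]

lemma det_one_sub_smul_eq_prod_roots (A : Matrix n n K) (u : K) :
    (1 - u • A).det = (A.charpoly.roots.map fun x => 1 - u * x).prod := by
  have haeval : aeval A (1 - C u * X) = 1 - u • A := by simp [Algebra.smul_def]
  have heval : (fun x => (1 - C u * X).eval x) = fun x => 1 - u * x := by
    ext x
    simp
  rw [← haeval, det_aeval_eq_prod_roots, heval]

lemma roots_charpoly_pow (A : Matrix n n K) (k : ℕ) :
    (A ^ k).charpoly.roots = A.charpoly.roots.map fun x => x ^ k := by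
  have hcharpoly : (A ^ k).charpoly =
      ((A.charpoly.roots.map fun x => x ^ k).map fun a => X - C a).prod := by
    refine Polynomial.funext fun z => ?_
    have hdet := det_aeval_eq_prod_roots A (C z - X ^ k)
    rw [Matrix.eval_charpoly, eval_multiset_prod, Multiset.map_map, Multiset.map_map]
    simpa [Matrix.algebraMap_eq_diagonal, Pi.algebraMap_def] using hdet
  rw [hcharpoly, roots_multiset_prod_X_sub_C]

lemma trace_pow_eq_sum_roots (A : Matrix n n K) (k : ℕ) :
    (A ^ k).trace = (A.charpoly.roots.map fun x => x ^ k).sum := by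
  rw [Matrix.trace_eq_sum_roots_charpoly, roots_charpoly_pow]

end Eigenvalues

section Analysis

open Polynomial

lemma hasSum_multiset_sum_map {ι κ M : Type*} [AddCommMonoid M] [TopologicalSpace M]
    [ContinuousAdd M] {s : Multiset κ} {f : κ → ι → M} {a : κ → M}
    (h : ∀ x ∈ s, HasSum (f x) (a x)) :
    HasSum (fun i => (s.map fun x => f x i).sum) (s.map a).sum := by
  induction s using Multiset.induction_on with
  | empty => simp
  | cons x s ih =>
    simp only [Multiset.map_cons, Multiset.sum_cons]
    exact (h x (Multiset.mem_cons_self x s)).add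
      (ih fun y hy => h y (Multiset.mem_cons_of_mem hy))

variable {n : Type*} [Fintype n] [DecidableEq n] (A : Matrix n n ℂ)

lemma hasSum_trace_pow {u : ℂ} (hu : ∀ x ∈ A.charpoly.roots, ‖u * x‖ < 1) :
    HasSum (fun k : ℕ+ => (A ^ (k : ℕ)).trace * (u ^ (k : ℕ) / k))
      (A.charpoly.roots.map fun x => -Complex.log (1 - u * x)).sum := by
  refine (hasSum_multiset_sum_map fun x hx => hasSum_pnat_pow_div (hu x hx)).congr_fun fun k => ?_
  rw [trace_pow_eq_sum_roots, ← Multiset.sum_map_mul_right]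
  refine congrArg Multiset.sum (Multiset.map_congr rfl fun x _ => ?_)
  ring

lemma exp_sum_neg_log_one_sub {u : ℂ} (hu : ∀ x ∈ A.charpoly.roots, ‖u * x‖ < 1) :
    Complex.exp (A.charpoly.roots.map fun x => -Complex.log (1 - u * x)).sum =
      ((1 - u • A).det)⁻¹ := by
  rw [Complex.exp_multiset_sum, det_one_sub_smul_eq_prod_roots, Multiset.map_map,
    ← Multiset.prod_map_inv]
  refine congrArg Multiset.prod (Multiset.map_congr rfl fun x hx => ?_)
  have hne : 1 - u * x ≠ 0 := sub_ne_zero.2 fun h => (hu x hx).ne (by rw [← h, norm_one])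
  rw [Function.comp_apply, Complex.exp_neg, Complex.exp_log hne]

lemma eventually_norm_mul_root_lt_one (p : ℂ[X]) :
    ∀ᶠ u in 𝓝 (0 : ℂ), ∀ x ∈ p.roots, ‖u * x‖ < 1 := by
  have hroot (x : ℂ) : ∀ᶠ u in 𝓝 (0 : ℂ), ‖u * x‖ < 1 := by
    have hc : Continuous fun u : ℂ => ‖u * x‖ := by fun_prop
    exact hc.continuousAt.eventually_lt continuousAt_const (by simp)
  simpa only [Multiset.mem_toFinset] using
    (Filter.eventually_all_finset p.roots.toFinset).2 fun x _ => hroot x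

lemma analyticAt_det_one_sub_smul (z : ℂ) : AnalyticAt ℂ (fun u => (1 - u • A).det) z := by
  simp only [Matrix.det_apply', Matrix.sub_apply, Matrix.smul_apply, smul_eq_mul]
  fun_prop

lemma meromorphic_inv_det_one_sub_smul : Meromorphic fun u : ℂ => ((1 - u • A).det)⁻¹ :=
  fun z => (analyticAt_det_one_sub_smul A z).meromorphicAt.inv

lemma meromorphicOrderAt_inv_det_one_sub_smul {a : ℂ} (ha : a ≠ 0) :
    meromorphicOrderAt (fun u => ((1 - u • A).det)⁻¹) a⁻¹ =
      ((-(A.charpoly.rootMultiplicity a : ℤ) : ℤ) : WithTop ℤ) := by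
  obtain ⟨q, hq, hqa⟩ := A.charpoly.exists_eq_pow_rootMultiplicity_mul_and_not_dvd
    A.charpoly_monic.ne_zero a
  set k := A.charpoly.rootMultiplicity a
  set g : ℂ → ℂ := fun u => u ^ Fintype.card n * (-a / u) ^ k * q.eval u⁻¹ with hg_def
  have hdet {u : ℂ} (hu : u ≠ 0) : (1 - u • A).det = (u - a⁻¹) ^ k * g u := by
    have hlin : u⁻¹ - a = (-a / u) * (u - a⁻¹) := by
      field_simp
      ring
    rw [det_one_sub_smul_eq_pow_mul_eval_charpoly A hu, hq, eval_mul, eval_pow, eval_sub, eval_X,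
      eval_C, hlin, mul_pow]
    ring
  have hg : AnalyticAt ℂ g a⁻¹ := by
    have hinv : AnalyticAt ℂ (fun u : ℂ => u⁻¹) a⁻¹ := analyticAt_inv (inv_ne_zero ha)
    exact ((analyticAt_id.pow _).mul ((analyticAt_const.mul hinv).pow k)).mul
      (hinv.aeval_polynomial q)
  have hga : g a⁻¹ ≠ 0 := by
    have hqa' : q.eval a ≠ 0 := fun h => hqa (dvd_iff_isRoot.2 h)
    simp [hg_def, ha, hqa']
  refine (meromorphicOrderAt_eq_int_iff (meromorphic_inv_det_one_sub_smul A _)).2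
    ⟨g⁻¹, hg.inv hga, inv_ne_zero hga, ?_⟩
  filter_upwards [(eventually_ne_nhds (inv_ne_zero ha)).filter_mono nhdsWithin_le_nhds] with u hu
  rw [hdet hu, mul_inv, zpow_neg, zpow_natCast, smul_eq_mul, Pi.inv_apply]

lemma meromorphicOrderAt_eq_of_eventuallyEq {𝕜 E : Type*} [RCLike 𝕜] [NormedAddCommGroup E]
    [NormedSpace 𝕜 E] {f g : 𝕜 → E} (hf : Meromorphic f) (hg : Meromorphic g) {a : 𝕜}
    (h : f =ᶠ[𝓝 a] g) (b : 𝕜) : meromorphicOrderAt f b = meromorphicOrderAt g b := by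
  have htop : meromorphicOrderAt (f - g) a = ⊤ := by
    rw [meromorphicOrderAt_eq_top_iff]
    filter_upwards [h.filter_mono nhdsWithin_le_nhds] with u hu
    rw [Pi.sub_apply, hu, sub_self]
  have hall : meromorphicOrderAt (f - g) b = ⊤ := by
    by_contra hb
    exact (hf.sub hg).exists_meromorphicOrderAt_ne_top_iff_forall.1 ⟨b, hb⟩ a htop
  refine meromorphicOrderAt_congr ?_
  filter_upwards [meromorphicOrderAt_eq_top_iff.1 hall] with u hu
  exact sub_eq_zero.1 hu

end Analysis

theorem eventually_hasProd_eulerFactor {V : Type*} (G : SimpleGraph V) [Fintype G.Dart]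
    [DecidableEq G.Dart] :
    ∀ᶠ u in 𝓝 (0 : ℂ),
      HasProd (eulerFactor G u) ((1 - u • transitionMatrix (TwoStep G)).det)⁻¹ := by
  filter_upwards [eventually_norm_mul_root_lt_one (transitionMatrix (TwoStep G)).charpoly,
    Metric.ball_mem_nhds 0 one_pos] with u hroots hu
  rw [← exp_sum_neg_log_one_sub _ hroots]
  have hsum := hasSum_trace_pow _ hroots
  simp only [fun k : ℕ+ => trace_transitionMatrix_pow (R := TwoStep G) k.ne_zero] at hsum
  refine (periodicOrbitsEquivPrimeClass G).hasProd_iff.1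
    ((hasProd_periodicOrbits (mem_ball_zero_iff.1 hu) hsum).congr_fun fun γ => ?_)
  rw [Function.comp_apply, eulerFactor, length_periodicOrbitsEquivPrimeClass]

section Multiplicity

open scoped Matrix

variable {m n : Type*} [Fintype m] [Fintype n]

lemma finrank_ker_mulVecLin_add_card {K : Type*} [Field K] (N : Matrix m n K) :
    Module.finrank K N.mulVecLin.ker + Fintype.card m =
      Fintype.card n + Module.finrank K Nᵀ.mulVecLin.ker := by
  have hN := N.mulVecLin.finrank_range_add_finrank_ker
  have hNt := Nᵀ.mulVecLin.finrank_range_add_finrank_ker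
  have hrank := N.rank_transpose
  rw [Matrix.rank, Matrix.rank] at hrank
  rw [Module.finrank_fintype_fun_eq_card] at hN hNt
  omega

lemma maxGenEigenspace_eq_eigenspace_of_disjoint {K E : Type*} [Field K] [AddCommGroup E]
    [Module K E] {f : Module.End K E} {a : K}
    (h : Disjoint (f.eigenspace a) (LinearMap.range (f - a • 1))) :
    f.maxGenEigenspace a = f.eigenspace a := by
  rw [Module.End.eigenspace_def] at h ⊢
  have hpow (k : ℕ) (y : E) (hy : ((f - a • 1) ^ k) y = 0) : (f - a • 1) y = 0 := by
    induction k generalizing y with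
    | zero => rw [show y = 0 from hy, map_zero]
    | succ k ih =>
      rw [pow_succ, Module.End.mul_apply] at hy
      exact Submodule.disjoint_def.1 h _ (ih _ hy) (LinearMap.mem_range_self _ y)
  ext y
  rw [Module.End.mem_maxGenEigenspace, LinearMap.mem_ker]
  exact ⟨fun ⟨k, hk⟩ => hpow k y hk, fun hy => ⟨1, by rwa [pow_one]⟩⟩

variable [DecidableEq n] {𝕜 : Type*} [RCLike 𝕜]

open scoped ComplexOrder in
/-- An eigenvalue whose eigenvectors are orthogonal to the range of `M - a` is semisimple. -/
lemma rootMultiplicity_charpoly_eq_finrank_ker {M : Matrix n n 𝕜} {N : Matrix m n 𝕜} {a : 𝕜}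
    (hker : ∀ x, M *ᵥ x = a • x ↔ N *ᵥ x = 0)
    (hrange : ∀ x, ∃ y, M *ᵥ x - a • x = Nᴴ *ᵥ y) :
    M.charpoly.rootMultiplicity a = Module.finrank 𝕜 N.mulVecLin.ker := by
  let f : Module.End 𝕜 (n → 𝕜) := Matrix.toLin' M
  have hf (x : n → 𝕜) : (f - a • 1) x = M *ᵥ x - a • x := rfl
  have heigen : f.eigenspace a = N.mulVecLin.ker := by
    ext x
    exact Module.End.mem_eigenspace_iff.trans (hker x)
  have hdisj : Disjoint (f.eigenspace a) (LinearMap.range (f - a • 1)) := by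
    rw [heigen, Submodule.disjoint_def]
    rintro _ hx ⟨x, rfl⟩
    obtain ⟨y, hy⟩ := hrange x
    rw [LinearMap.mem_ker, hf, hy, Matrix.mulVecLin_apply, Matrix.mulVec_mulVec,
      Matrix.self_mul_conjTranspose_mulVec_eq_zero] at hx
    rw [hf, hy, hx]
  rw [← heigen, ← maxGenEigenspace_eq_eigenspace_of_disjoint hdisj,
    LinearMap.finrank_maxGenEigenspace_eq, Matrix.charpoly_toLin']

end Multiplicity

section EdgeScaling

variable {V : Type*} {K : Type*} [Field K]

/-- The space of functions on the vertices that are multiplied by `ε` along every edge: the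
constants on each component for `ε = 1`, the multiples of a 2-colouring with colours `±1`
for `ε = -1`. -/
def edgeScaling (G : SimpleGraph V) (ε : K) : Submodule K (V → K) where
  carrier := {f | ∀ u v, G.Adj u v → f u = ε * f v}
  add_mem' hf hg u v huv := by simp only [Pi.add_apply, hf u v huv, hg u v huv, mul_add]
  zero_mem' u v _ := by simp
  smul_mem' c f hf u v huv := by
    simp only [Pi.smul_apply, smul_eq_mul, hf u v huv, mul_left_comm]

variable {G : SimpleGraph V} {ε : K} {f : V → K}

lemma eq_pow_length_mul_of_mem_edgeScaling (hf : f ∈ edgeScaling G ε) {u v : V}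
    (w : G.Walk u v) : f u = ε ^ w.length * f v := by
  induction w with
  | nil => simp
  | cons huv w ih => rw [hf _ _ huv, ih, SimpleGraph.Walk.length_cons, pow_succ', mul_assoc]

lemma eq_zero_of_mem_edgeScaling (hconn : G.Connected) (hf : f ∈ edgeScaling G ε) {v : V}
    (hv : f v = 0) : f = 0 := by
  ext u
  obtain ⟨w⟩ := hconn.preconnected u v
  rw [eq_pow_length_mul_of_mem_edgeScaling hf w, hv, mul_zero, Pi.zero_apply]

lemma finrank_edgeScaling_eq_one (hconn : G.Connected) (hf : f ∈ edgeScaling G ε) (hf0 : f ≠ 0) :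
    Module.finrank K (edgeScaling G ε) = 1 := by
  obtain ⟨v⟩ := hconn.nonempty
  have hv : f v ≠ 0 := fun hv => hf0 (eq_zero_of_mem_edgeScaling hconn hf hv)
  refine finrank_eq_one ⟨f, hf⟩ (fun h => hf0 (congrArg Subtype.val h)) fun g =>
    ⟨g.1 v / f v, Subtype.ext (sub_eq_zero.1 ?_)⟩
  refine eq_zero_of_mem_edgeScaling hconn (Submodule.sub_mem _ (Subtype.prop _) g.2) (v := v) ?_
  simp [hv]

lemma finrank_edgeScaling_one (hconn : G.Connected) :
    Module.finrank K (edgeScaling G (1 : K)) = 1 := by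
  have := hconn.nonempty
  exact finrank_edgeScaling_eq_one hconn (f := 1) (fun _ _ _ => by simp) one_ne_zero

lemma finrank_edgeScaling_neg_one (hconn : G.Connected) (hbip : G.IsBipartite) :
    Module.finrank K (edgeScaling G (-1 : K)) = 1 := by
  have := hconn.nonempty
  obtain ⟨C⟩ := hbip
  refine finrank_edgeScaling_eq_one hconn (f := fun v => (-1) ^ (C v : ℕ)) (fun u v huv => ?_)
    (Function.ne_iff.2 ⟨Classical.arbitrary V, pow_ne_zero _ (by simp)⟩)
  have hne := C.valid huv
  have hcases : C u = 0 ∧ C v = 1 ∨ C u = 1 ∧ C v = 0 := by omega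
  rcases hcases with ⟨hu, hv⟩ | ⟨hu, hv⟩ <;> simp [hu, hv]

lemma isBipartite_of_mem_edgeScaling [CharZero K] (hconn : G.Connected)
    (hf : f ∈ edgeScaling G (-1)) (hf0 : f ≠ 0) : G.IsBipartite := by
  refine SimpleGraph.two_colorable_iff_forall_loop_even.2 fun v w => ?_
  have hv : f v ≠ 0 := fun hv => hf0 (eq_zero_of_mem_edgeScaling hconn hf hv)
  have hpow := eq_pow_length_mul_of_mem_edgeScaling hf w
  rwa [eq_comm, mul_eq_right₀ hv, neg_one_pow_eq_one_iff_even (by norm_num)] at hpow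

lemma finrank_edgeScaling_neg_one_eq_zero [CharZero K] (hconn : G.Connected)
    (hbip : ¬ G.IsBipartite) : Module.finrank K (edgeScaling G (-1 : K)) = 0 := by
  have hbot : edgeScaling G (-1 : K) = ⊥ := (Submodule.eq_bot_iff _).2 fun f hf =>
    by_contra fun hf0 => hbip (isBipartite_of_mem_edgeScaling hconn hf hf0)
  rw [hbot, finrank_bot]

end EdgeScaling

section EdgeMatrices

open scoped Matrix

variable {V : Type*}

lemma not_isTwoStepArc_self {G : SimpleGraph V} (e : G.Dart) : ¬ IsTwoStepArc G e e := by
  rintro ⟨g, hg, -, hfst, hsnd⟩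
  exact hg (SimpleGraph.Dart.ext _ _ (Prod.ext (by simpa using hfst) (by simpa using hsnd)))

variable [DecidableEq V]

/-- The matrix `S` with `(S x) v = ∑ x e`, summed over the oriented edges with origin `v`. -/
def originMatrix (G : SimpleGraph V) : Matrix V G.Dart ℂ :=
  Matrix.of fun v e => if e.fst = v then 1 else 0

/-- The matrix `T` with `(T x) v = ∑ x e`, summed over the oriented edges with terminus `v`. -/
def terminusMatrix (G : SimpleGraph V) : Matrix V G.Dart ℂ :=
  (originMatrix G).submatrix id SimpleGraph.Dart.symm

/-- The oriented incidence matrix `S - T` stacked on the unoriented one `S + T`, both with a column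
for each of the two orientations of an edge. -/
def incidenceMatrix (G : SimpleGraph V) : Matrix (V ⊕ V) G.Dart ℂ :=
  Matrix.fromRows (originMatrix G - terminusMatrix G) (originMatrix G + terminusMatrix G)

/-- The non-backtracking edge matrix `B`; its square is the `0`-`1` matrix of the 2-step-arcs. -/
def edgeMatrix (G : SimpleGraph V) : Matrix G.Dart G.Dart ℂ :=
  Matrix.of fun e g => if g.fst = e.snd ∧ g ≠ e.symm then 1 else 0

variable {G : SimpleGraph V}

lemma conjTranspose_incidenceMatrix : (incidenceMatrix G)ᴴ = (incidenceMatrix G)ᵀ := by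
  ext e (v | v) <;>
    simp only [incidenceMatrix, terminusMatrix, originMatrix, Matrix.conjTranspose_apply,
      Matrix.transpose_apply, Matrix.fromRows_apply_inl, Matrix.fromRows_apply_inr,
      Matrix.sub_apply, Matrix.add_apply, Matrix.submatrix_apply, Matrix.of_apply] <;>
    split_ifs <;> simp

section Vertices

variable [Fintype V]

lemma transpose_originMatrix_mulVec (p : V → ℂ) :
    (originMatrix G)ᵀ *ᵥ p = fun e => p e.fst := by
  ext e
  simp [originMatrix, Matrix.mulVec, dotProduct]

lemma transpose_terminusMatrix_mulVec (p : V → ℂ) :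
    (terminusMatrix G)ᵀ *ᵥ p = fun e => p e.snd := by
  ext e
  simp [terminusMatrix, originMatrix, Matrix.mulVec, dotProduct]

lemma transpose_incidenceMatrix_mulVec_sumElim (p q : V → ℂ) :
    (incidenceMatrix G)ᵀ *ᵥ Sum.elim p q =
      fun e => p e.fst - p e.snd + (q e.fst + q e.snd) := by
  rw [incidenceMatrix, Matrix.transpose_fromRows, Matrix.fromCols_mulVec_sumElim,
    Matrix.transpose_sub, Matrix.transpose_add, Matrix.sub_mulVec, Matrix.add_mulVec,
    transpose_originMatrix_mulVec, transpose_originMatrix_mulVec,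
    transpose_terminusMatrix_mulVec, transpose_terminusMatrix_mulVec]
  rfl

lemma transpose_incidenceMatrix_mulVec_eq_zero_iff {p q : V → ℂ} :
    (incidenceMatrix G)ᵀ *ᵥ Sum.elim p q = 0 ↔
      p ∈ edgeScaling G (1 : ℂ) ∧ q ∈ edgeScaling G (-1 : ℂ) := by
  rw [transpose_incidenceMatrix_mulVec_sumElim, funext_iff]
  refine ⟨fun h => ⟨fun u v huv => ?_, fun u v huv => ?_⟩, fun ⟨hp, hq⟩ e => ?_⟩
  · have huv' := h ⟨(u, v), huv⟩
    have hvu := h ⟨(v, u), huv.symm⟩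
    simp only [Pi.zero_apply] at huv' hvu
    linear_combination (huv' - hvu) / 2
  · have huv' := h ⟨(u, v), huv⟩
    have hvu := h ⟨(v, u), huv.symm⟩
    simp only [Pi.zero_apply] at huv' hvu
    linear_combination (huv' + hvu) / 2
  · rw [hp _ _ e.adj, hq _ _ e.adj, Pi.zero_apply]
    ring

/-- A vector killed by the transposed incidence matrix is a pair of functions scaled by `1` and
by `-1` along the edges. -/
def kerTransposeIncidenceEquiv (G : SimpleGraph V) :
    (incidenceMatrix G)ᵀ.mulVecLin.ker ≃ₗ[ℂ] edgeScaling G (1 : ℂ) × edgeScaling G (-1 : ℂ) where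
  toFun z :=
    have hz := transpose_incidenceMatrix_mulVec_eq_zero_iff.1
      ((congrArg _ (Sum.elim_comp_inl_inr z.1)).trans z.2)
    (⟨z.1 ∘ Sum.inl, hz.1⟩, ⟨z.1 ∘ Sum.inr, hz.2⟩)
  map_add' _ _ := rfl
  map_smul' _ _ := rfl
  invFun pq := ⟨Sum.elim pq.1 pq.2,
    transpose_incidenceMatrix_mulVec_eq_zero_iff.2 ⟨pq.1.2, pq.2.2⟩⟩
  left_inv z := Subtype.ext (Sum.elim_comp_inl_inr z.1)
  right_inv _ := rfl

end Vertices

section Darts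

variable [Fintype G.Dart]

lemma originMatrix_mulVec_comp_symm (x : G.Dart → ℂ) :
    originMatrix G *ᵥ (x ∘ SimpleGraph.Dart.symm) = terminusMatrix G *ᵥ x := by
  ext v
  exact Fintype.sum_equiv SimpleGraph.Dart.symm_involutive.toPerm _ _ fun e => by
    simp [terminusMatrix]

lemma incidenceMatrix_mulVec_eq_zero_iff {x : G.Dart → ℂ} :
    incidenceMatrix G *ᵥ x = 0 ↔ originMatrix G *ᵥ x = 0 ∧ terminusMatrix G *ᵥ x = 0 := by
  rw [incidenceMatrix, Matrix.fromRows_mulVec, Matrix.sub_mulVec, Matrix.add_mulVec,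
    ← Sum.elim_zero_zero, Sum.elim_eq_iff]
  constructor
  · rintro ⟨hsub, hadd⟩
    rw [sub_eq_zero] at hsub
    rw [hsub, ← two_smul ℂ, smul_eq_zero_iff_right two_ne_zero] at hadd
    exact ⟨hsub.trans hadd, hadd⟩
  · rintro ⟨hS, hT⟩
    simp [hS, hT]

lemma edgeMatrix_mulVec (x : G.Dart → ℂ) (e : G.Dart) :
    (edgeMatrix G *ᵥ x) e = (originMatrix G *ᵥ x) e.snd - x e.symm := by
  have hentry (g : G.Dart) : edgeMatrix G e g =
      originMatrix G e.snd g - if g = e.symm then 1 else 0 := by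
    by_cases hg : g = e.symm <;> simp [edgeMatrix, originMatrix, hg]
  simp only [Matrix.mulVec, dotProduct, hentry, sub_mul, Finset.sum_sub_distrib, ite_mul, one_mul,
    zero_mul, Finset.sum_ite_eq', Finset.mem_univ, if_true]

lemma originMatrix_mulVec_fst_of_edgeMatrix_mulVec {ε : ℂ} {x : G.Dart → ℂ}
    (hx : edgeMatrix G *ᵥ x = ε • x) (e : G.Dart) :
    (originMatrix G *ᵥ x) e.fst = x e + ε * x e.symm := by
  have he := congrFun hx e.symm
  simp only [edgeMatrix_mulVec, SimpleGraph.Dart.symm_symm, SimpleGraph.Dart.symm_toProd,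
    Prod.snd_swap, Pi.smul_apply, smul_eq_mul] at he
  linear_combination he

lemma originMatrix_mulVec_mem_edgeScaling {ε : ℂ} (hε : ε ^ 2 = 1) {x : G.Dart → ℂ}
    (hx : edgeMatrix G *ᵥ x = ε • x) : originMatrix G *ᵥ x ∈ edgeScaling G ε := by
  intro u v huv
  have hu := originMatrix_mulVec_fst_of_edgeMatrix_mulVec hx ⟨(u, v), huv⟩
  have hv := originMatrix_mulVec_fst_of_edgeMatrix_mulVec hx ⟨(v, u), huv.symm⟩
  simp only [SimpleGraph.Dart.symm_mk, Prod.swap_prod_mk] at hu hv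
  linear_combination hu - ε * hv - x ⟨(u, v), huv⟩ * hε

lemma edgeMatrix_sq_mulVec_sub (x : G.Dart → ℂ) (e : G.Dart) :
    (edgeMatrix G *ᵥ (edgeMatrix G *ᵥ x)) e - x e =
      (originMatrix G *ᵥ (edgeMatrix G *ᵥ x)) e.snd - (originMatrix G *ᵥ x) e.fst := by
  rw [edgeMatrix_mulVec (edgeMatrix G *ᵥ x), edgeMatrix_mulVec x e.symm,
    SimpleGraph.Dart.symm_symm, SimpleGraph.Dart.symm_toProd, Prod.snd_swap]
  ring

open Classical in
lemma edgeMatrix_mul_self_apply (e f : G.Dart) :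
    (edgeMatrix G * edgeMatrix G) e f = if IsTwoStepArc G e f then 1 else 0 := by
  have hterm (g : G.Dart) : edgeMatrix G e g * edgeMatrix G g f =
      if g ≠ e.symm ∧ g ≠ f.symm ∧ g.fst = e.snd ∧ g.snd = f.fst then 1 else 0 := by
    have hfg : f = g.symm ↔ g = f.symm := by
      constructor <;> rintro rfl <;> rw [SimpleGraph.Dart.symm_symm]
    simp only [edgeMatrix, Matrix.of_apply, ← ite_and, mul_ite, mul_one, mul_zero, Ne, hfg]
    exact if_congr (by rw [eq_comm (a := f.fst)]; tauto) rfl rfl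
  simp only [Matrix.mul_apply, hterm]
  split_ifs with h
  · obtain ⟨g, hg⟩ := h
    rw [Finset.sum_eq_single g (fun g' _ hg' => if_neg fun h' => hg' ?_) (by simp), if_pos hg]
    exact SimpleGraph.Dart.ext _ _
      (Prod.ext (h'.2.2.1.trans hg.2.2.1.symm) (h'.2.2.2.trans hg.2.2.2.symm))
  · exact Finset.sum_eq_zero fun g _ => if_neg fun hg => h ⟨g, hg⟩

lemma transitionMatrix_twoStep :
    transitionMatrix (TwoStep G) = edgeMatrix G * edgeMatrix G + 1 := by
  classical
  ext e f
  rw [Matrix.add_apply, edgeMatrix_mul_self_apply, Matrix.one_apply]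
  by_cases hef : e = f
  · simp [transitionMatrix, TwoStep, hef, not_isTwoStepArc_self]
  · rw [if_neg hef, add_zero]
    exact if_congr (or_iff_left hef) rfl rfl

lemma transitionMatrix_twoStep_mulVec (x : G.Dart → ℂ) :
    transitionMatrix (TwoStep G) *ᵥ x = edgeMatrix G *ᵥ (edgeMatrix G *ᵥ x) + x := by
  rw [transitionMatrix_twoStep, Matrix.add_mulVec, Matrix.one_mulVec, Matrix.mulVec_mulVec]

end Darts

section Eigenvectors

variable [Fintype V] [DecidableRel G.Adj]

lemma sum_mul_comp_fst (x : G.Dart → ℂ) (p : V → ℂ) :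
    ∑ e : G.Dart, x e * p e.fst = ∑ v, (originMatrix G *ᵥ x) v * p v := by
  have hadjoint := Matrix.dotProduct_mulVec x (originMatrix G)ᵀ p
  rwa [Matrix.vecMul_transpose, transpose_originMatrix_mulVec] at hadjoint

-- All values of `S x` have the same square `s`, and pairing `x` with `Sᵀ S x` gives `n s = m s`.
lemma originMatrix_mulVec_eq_zero_of_edgeMatrix_mulVec (hconn : G.Connected)
    (hcard : Fintype.card V ≠ G.edgeFinset.card) {ε : ℂ} (hε : ε ^ 2 = 1) {x : G.Dart → ℂ}
    (hx : edgeMatrix G *ᵥ x = ε • x) : originMatrix G *ᵥ x = 0 := by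
  set a := originMatrix G *ᵥ x with ha
  have hscaling : a ∈ edgeScaling G ε := originMatrix_mulVec_mem_edgeScaling hε hx
  obtain ⟨v₀⟩ := hconn.nonempty
  have hsq (v : V) : a v ^ 2 = a v₀ ^ 2 := by
    obtain ⟨w⟩ := hconn.preconnected v v₀
    rw [eq_pow_length_mul_of_mem_edgeScaling hscaling w, mul_pow, pow_right_comm, hε, one_pow,
      one_mul]
  have hpair : ∑ e : G.Dart, x e * a e.fst = Fintype.card V * a v₀ ^ 2 := by
    simp [sum_mul_comp_fst, ← ha, ← pow_two, hsq]
  have hsymm : ∑ e : G.Dart, x e.symm * a e.fst = ε * ∑ e : G.Dart, x e * a e.fst := by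
    rw [Finset.mul_sum]
    refine Fintype.sum_equiv SimpleGraph.Dart.symm_involutive.toPerm _ _ fun e => ?_
    simp only [Function.Involutive.coe_toPerm, SimpleGraph.Dart.symm_toProd, Prod.fst_swap,
      hscaling _ _ e.adj]
    ring
  have hdarts : ∑ e : G.Dart, a e.fst ^ 2 = 2 * G.edgeFinset.card * a v₀ ^ 2 := by
    simp [hsq, G.dart_card_eq_twice_card_edges]
  have hsum : ∑ e : G.Dart, a e.fst ^ 2 =
      ∑ e : G.Dart, x e * a e.fst + ε * ∑ e : G.Dart, x e.symm * a e.fst := by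
    rw [Finset.mul_sum, ← Finset.sum_add_distrib]
    exact Finset.sum_congr rfl fun e _ => by
      linear_combination a e.fst * originMatrix_mulVec_fst_of_edgeMatrix_mulVec hx e
  have hzero : ((Fintype.card V : ℂ) - G.edgeFinset.card) * a v₀ ^ 2 = 0 := by
    rw [hdarts, hsymm, hpair] at hsum
    linear_combination -hsum / 2 - Fintype.card V * a v₀ ^ 2 * hε / 2
  have hne : (Fintype.card V : ℂ) - G.edgeFinset.card ≠ 0 := sub_ne_zero.2 (mod_cast hcard)
  exact funext fun v => pow_eq_zero_iff two_ne_zero |>.1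
    ((hsq v).trans ((mul_eq_zero.1 hzero).resolve_left hne))

lemma edgeMatrix_mulVec_of_originMatrix_mulVec_eq_zero {x : G.Dart → ℂ}
    (hx : originMatrix G *ᵥ x = 0) : edgeMatrix G *ᵥ x = -(x ∘ SimpleGraph.Dart.symm) := by
  ext e
  simp [edgeMatrix_mulVec, hx]

lemma transitionMatrix_mulVec_eq_two_smul_iff (hconn : G.Connected)
    (hcard : Fintype.card V ≠ G.edgeFinset.card) {x : G.Dart → ℂ} :
    transitionMatrix (TwoStep G) *ᵥ x = (2 : ℂ) • x ↔ incidenceMatrix G *ᵥ x = 0 := by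
  rw [transitionMatrix_twoStep_mulVec, two_smul, add_left_inj, incidenceMatrix_mulVec_eq_zero_iff]
  set y := edgeMatrix G *ᵥ x with hy
  constructor
  · intro hyx
    have hadd : originMatrix G *ᵥ (x + y) = 0 :=
      originMatrix_mulVec_eq_zero_of_edgeMatrix_mulVec hconn hcard (ε := 1) (one_pow 2) (by
        rw [Matrix.mulVec_add, hyx, ← hy, one_smul, add_comm])
    have hsub : originMatrix G *ᵥ (x - y) = 0 :=
      originMatrix_mulVec_eq_zero_of_edgeMatrix_mulVec hconn hcard (ε := -1) (by norm_num) (by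
        rw [Matrix.mulVec_sub, hyx, ← hy, neg_one_smul, neg_sub])
    rw [Matrix.mulVec_add] at hadd
    rw [Matrix.mulVec_sub, sub_eq_zero] at hsub
    rw [← hsub, ← two_smul ℂ, smul_eq_zero_iff_right two_ne_zero] at hadd
    refine ⟨hadd, ?_⟩
    rw [← originMatrix_mulVec_comp_symm, ← neg_eq_zero, ← Matrix.mulVec_neg,
      ← edgeMatrix_mulVec_of_originMatrix_mulVec_eq_zero hadd, ← hy, ← hsub, hadd]
  · rintro ⟨hS, hT⟩
    have hyS : originMatrix G *ᵥ y = 0 := by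
      rw [hy, edgeMatrix_mulVec_of_originMatrix_mulVec_eq_zero hS, Matrix.mulVec_neg,
        originMatrix_mulVec_comp_symm, hT, neg_zero]
    ext e
    rw [← sub_eq_zero, edgeMatrix_sq_mulVec_sub, hS, ← hy, hyS, Pi.zero_apply, Pi.zero_apply,
      sub_zero]

lemma exists_transitionMatrix_mulVec_sub_eq (x : G.Dart → ℂ) :
    ∃ y, transitionMatrix (TwoStep G) *ᵥ x - (2 : ℂ) • x = (incidenceMatrix G)ᴴ *ᵥ y := by
  set a := originMatrix G *ᵥ x
  set b := originMatrix G *ᵥ (edgeMatrix G *ᵥ x)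
  refine ⟨Sum.elim (-(2 : ℂ)⁻¹ • (a + b)) ((2 : ℂ)⁻¹ • (b - a)), ?_⟩
  rw [conjTranspose_incidenceMatrix, transpose_incidenceMatrix_mulVec_sumElim,
    transitionMatrix_twoStep_mulVec]
  ext e
  have he := edgeMatrix_sq_mulVec_sub x e
  simp only [Pi.sub_apply, Pi.add_apply, Pi.smul_apply, smul_eq_mul]
  linear_combination he

theorem rootMultiplicity_two_charpoly_transitionMatrix (hconn : G.Connected)
    (hcard : Fintype.card V ≠ G.edgeFinset.card) :
    (transitionMatrix (TwoStep G)).charpoly.rootMultiplicity 2 + 2 * Fintype.card V =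
      2 * G.edgeFinset.card + (1 + Module.finrank ℂ (edgeScaling G (-1 : ℂ))) := by
  have hrank := finrank_ker_mulVecLin_add_card (incidenceMatrix G)
  rw [(kerTransposeIncidenceEquiv G).finrank_eq, Module.finrank_prod,
    finrank_edgeScaling_one hconn, Fintype.card_sum, G.dart_card_eq_twice_card_edges] at hrank
  rw [rootMultiplicity_charpoly_eq_finrank_ker
    (fun _ => transitionMatrix_mulVec_eq_two_smul_iff hconn hcard)
    exists_transitionMatrix_mulVec_sub_eq]
  omega

end Eigenvectors

end EdgeMatrices

lemma card_lt_card_edgeFinset {V : Type*} [Fintype V] {G : SimpleGraph V} [DecidableRel G.Adj]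
    [Nonempty V] (hdeg : 3 ≤ G.minDegree) : Fintype.card V < G.edgeFinset.card := by
  have hpos : 0 < Fintype.card V := Fintype.card_pos
  have hsum : Fintype.card V * 3 ≤ ∑ v, G.degree v :=
    Finset.card_nsmul_le_sum _ _ _ fun v _ => hdeg.trans (G.minDegree_le_degree v)
  rw [G.sum_degrees_eq_twice_card_edges] at hsum
  omega

lemma IsMeromorphicContinuation.meromorphicOrderAt_eq {f Z W : ℂ → ℂ}
    (hZ : IsMeromorphicContinuation f Z) (hW : IsMeromorphicContinuation f W) (a : ℂ) :
    meromorphicOrderAt Z a = meromorphicOrderAt W a :=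
  meromorphicOrderAt_eq_of_eventuallyEq hZ.1 hW.1
    (by filter_upwards [hZ.2, hW.2] with u hu hu' using hu.trans hu'.symm) a

lemma isMeromorphicContinuation_modifiedZeta {V : Type*} (G : SimpleGraph V) [Fintype G.Dart]
    [DecidableEq G.Dart] :
    IsMeromorphicContinuation (modifiedZeta G)
      fun u => ((1 - u • transitionMatrix (TwoStep G)).det)⁻¹ :=
  ⟨meromorphic_inv_det_one_sub_smul _,
    (eventually_hasProd_eulerFactor G).mono fun _ hu => hu.tprod_eq.symm⟩

lemma IsMeromorphicContinuation.hasPoleOfOrder {V : Type*} {G : SimpleGraph V} [Fintype G.Dart]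
    [DecidableEq G.Dart] {Z : ℂ → ℂ} (hZ : IsMeromorphicContinuation (modifiedZeta G) Z) {a : ℂ}
    (ha : a ≠ 0) {k : ℤ} (hk : 0 < k)
    (hroot : (transitionMatrix (TwoStep G)).charpoly.rootMultiplicity a = k) :
    HasPoleOfOrder Z a⁻¹ k := by
  refine ⟨hZ.1 _, hk, ?_⟩
  rw [hZ.meromorphicOrderAt_eq (isMeromorphicContinuation_modifiedZeta G),
    meromorphicOrderAt_inv_det_one_sub_smul _ ha, hroot]

end ModifiedZeta

open ModifiedZeta in
theorem corollary3p5_general {V : Type*} [Fintype V] (G : SimpleGraph V) [DecidableRel G.Adj]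
    (hconn : G.Connected) (hcard : Fintype.card V < G.edgeFinset.card) :
    (∀ᶠ u in 𝓝 (0 : ℂ), Multipliable (eulerFactor G u)) ∧
    (∃ Z : ℂ → ℂ, IsMeromorphicContinuation (modifiedZeta G) Z) ∧
    ∀ Z : ℂ → ℂ, IsMeromorphicContinuation (modifiedZeta G) Z →
      (G.IsBipartite → HasPoleOfOrder Z (1 / 2)
        (2 * ((G.edgeFinset.card : ℤ) - (Fintype.card V : ℤ) + 1))) ∧
      (¬ G.IsBipartite → HasPoleOfOrder Z (1 / 2)
        (2 * ((G.edgeFinset.card : ℤ) - (Fintype.card V : ℤ)) + 1)) := by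
  classical
  refine ⟨(eventually_hasProd_eulerFactor G).mono fun _ hu => hu.multipliable,
    ⟨_, isMeromorphicContinuation_modifiedZeta G⟩, fun Z hZ => ?_⟩
  have hmult := rootMultiplicity_two_charpoly_transitionMatrix hconn hcard.ne
  rw [one_div]
  constructor <;> intro hbip
  · rw [finrank_edgeScaling_neg_one hconn hbip] at hmult
    exact hZ.hasPoleOfOrder two_ne_zero (by omega) (by omega)
  · rw [finrank_edgeScaling_neg_one_eq_zero hconn hbip] at hmult
    exact hZ.hasPoleOfOrder two_ne_zero (by omega) (by omega)

theorem corollary3p5 {V : Type*} [Fintype V] [DecidableEq V] (G : SimpleGraph V)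
    [DecidableRel G.Adj] (hconn : G.Connected) (hdeg : 3 ≤ G.minDegree) :
    -- the Euler product converges for all sufficiently small `u`
    (∀ᶠ u in 𝓝 (0 : ℂ), Multipliable (ModifiedZeta.eulerFactor G u)) ∧
    -- it has a meromorphic continuation to the complex plane
    (∃ Z : ℂ → ℂ, ModifiedZeta.IsMeromorphicContinuation (ModifiedZeta.modifiedZeta G) Z) ∧
    -- and every such continuation has a pole of the stated order at `1 / 2`
    ∀ Z : ℂ → ℂ, ModifiedZeta.IsMeromorphicContinuation (ModifiedZeta.modifiedZeta G) Z →
      (G.IsBipartite → ModifiedZeta.HasPoleOfOrder Z (1 / 2)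
        (2 * ((G.edgeFinset.card : ℤ) - (Fintype.card V : ℤ) + 1))) ∧
      (¬ G.IsBipartite → ModifiedZeta.HasPoleOfOrder Z (1 / 2)
        (2 * ((G.edgeFinset.card : ℤ) - (Fintype.card V : ℤ)) + 1)) := by
  have := hconn.nonempty
  exact corollary3p5_general G hconn (ModifiedZeta.card_lt_card_edgeFinset hdeg)
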